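/- \textbf{Theorem 2.} Let an orientation of the $n$-dimensional hypercube be described by its outmap $o:\{0,1\}^n\to\{0,1\}^n$, where the edge between $v$ and $v\oplus e_i$ is directed away from $v$ if and only if $o(v)_i=1$ (consistency requires $o(v)_i\neq o(v\oplus e_i)_i$). It is a \emph{unique sink orientation (USO)} if every non-empty face has exactly one vertex without outgoing edges inside that face. It is \emph{Matoušek-type} if $o(v)=PAP^{T}(v\oplus s)$ over $GF(2)$ for all $v$, for some permutation matrix $P$, some invertible upper-triangular matrix $A\in\{0,1\}^{n\times n}$ and some $s\in\{0,1\}^n$. A USO $o$ is \emph{realizable} if there are a real $n\times n$ P-matrix $M$ (all principal minors positive) and $q\in\mathbb{R}^n$ such that, with $B_v$ denoting the matrix whose $j$-th column is $-M_j$ if $v_j=1$ and $e_j$ if $v_j=0$, one has $(B_v^{-1}q)_i\neq 0$ for all $v,i$ (non-degeneracy), and $o(v)_i=1$ if and only if $(B_v^{-1}q)_i<0$. A deterministic algorithm accesses $o$ only through vertex evaluations: it adaptively queries vertices $v$, receives $o(v)$, and finally outputs a vertex; all other computation is free. There exist a deterministic algorithm (one for each dimension $n$) and a constant $C$ such that for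 every $n$ and every $n$-dimensional realizable Matoušek-type USO $o$, the algorithm outputs the sink of $o$, and, if $n\ge 2$, it makes at most $C\log^2 n$ vertex evaluations. -/

import Mathlib

namespace MatousekUSO

/-- Vertices of the `n`-dimensional hypercube, as vectors over `GF(2)`. -/
abbrev Vertex (n : ℕ) : Type := Fin n → ZMod 2

/-- A function assigning to each vertex its outmap: the edge between `v` and `v ⊕ eᵢ` is directed
away from `v` if `o v i = 1`. -/
abbrev Outmap (n : ℕ) : Type := Vertex n → Vertex n

/-- `o` is an orientation of the hypercube: the two endpoints of each edge agree on its
direction. -/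
def IsOrientation {n : ℕ} (o : Outmap n) : Prop :=
  ∀ (v : Vertex n) (i : Fin n), o v i ≠ o (v + Pi.single i 1) i

/-- The face of the hypercube that contains `v` and is spanned by the dimensions in `I`. -/
def face {n : ℕ} (v : Vertex n) (I : Set (Fin n)) : Set (Vertex n) :=
  {w | ∀ i, i ∉ I → w i = v i}

/-- Unique sink orientation: every non-empty face has exactly one vertex without outgoing edges
inside the face. -/
def IsUSO {n : ℕ} (o : Outmap n) : Prop :=
  IsOrientation o ∧
    ∀ (v : Vertex n) (I : Set (Fin n)), ∃! w, w ∈ face v I ∧ ∀ i ∈ I, o w i = 0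

/-- A sink of the whole hypercube: a vertex with no outgoing edges. -/
def IsSink {n : ℕ} (o : Outmap n) (v : Vertex n) : Prop :=
  o v = 0

/-- A Matoušek-type orientation: `o v = M (v ⊕ s)` with `M = P A Pᵀ` for a permutation matrix `P`,
an invertible upper-triangular matrix `A` over `GF(2)` and a vertex `s`. -/
def IsMatousekType {n : ℕ} (o : Outmap n) : Prop :=
  ∃ (σ : Equiv.Perm (Fin n)) (A : Matrix (Fin n) (Fin n) (ZMod 2)) (s : Vertex n),
    IsUnit A ∧ A.BlockTriangular id ∧
      ∀ v, o v = Matrix.mulVec (σ.permMatrix (ZMod 2) * A * (σ.permMatrix (ZMod 2)).transpose)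
        (v + s)

/-- A real square matrix is a P-matrix if all its principal minors are positive. -/
def IsPMatrix {n : ℕ} (M : Matrix (Fin n) (Fin n) ℝ) : Prop :=
  ∀ S : Finset (Fin n),
    0 < (M.submatrix (fun i : S => (i : Fin n)) (fun i : S => (i : Fin n))).det

/-- The complementary basis matrix at the vertex `v`, for the linear complementarity problem
`w - M z = q`, `w ≥ 0`, `z ≥ 0`, `wᵀ z = 0`: the column `j` is the column of `z j` in this system,
namely `-M_j`, if `v j = 1`, and the column of `w j`, namely the unit vector, if `v j = 0`. -/
def basisMatrix {n : ℕ} (M : Matrix (Fin n) (Fin n) ℝ) (v : Vertex n) :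
    Matrix (Fin n) (Fin n) ℝ :=
  Matrix.of fun i j => if v j = 1 then -M i j else (1 : Matrix (Fin n) (Fin n) ℝ) i j

/-- The values of the basic variables of the problem `(M, q)` at the vertex `v`. For a P-matrix `M`
the basis matrix is invertible, so the inverse is a genuine one. -/
noncomputable def basicValue {n : ℕ} (M : Matrix (Fin n) (Fin n) ℝ) (q : Fin n → ℝ)
    (v : Vertex n) : Fin n → ℝ :=
  Matrix.mulVec (basisMatrix M v)⁻¹ q

/-- Non-degeneracy of the problem `(M, q)`: no basic variable is zero at any vertex. -/
def IsNondegenerate {n : ℕ} (M : Matrix (Fin n) (Fin n) ℝ) (q : Fin n → ℝ) : Prop :=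
  ∀ (v : Vertex n) (i : Fin n), basicValue M q v i ≠ 0

/-- The USO `o` is produced by the Stickney-Watson reduction from a non-degenerate P-matrix linear
complementarity problem `(M, q)`: the edge at `v` in dimension `i` is outgoing exactly if the
`i`-th basic variable is negative at `v`. -/
def IsRealizable {n : ℕ} (o : Outmap n) : Prop :=
  IsUSO o ∧ ∃ (M : Matrix (Fin n) (Fin n) ℝ) (q : Fin n → ℝ),
    IsPMatrix M ∧ IsNondegenerate M q ∧ ∀ v i, o v i = 1 ↔ basicValue M q v i < 0

/-- A deterministic adaptive algorithm in the vertex evaluation model: it either stops and outputs a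
vertex, or queries a vertex and continues depending on the outmap that the oracle returns. Other
computation is free. -/
inductive SinkAlgorithm (n : ℕ) : Type
  | output (v : Vertex n) : SinkAlgorithm n
  | query (v : Vertex n) (next : Vertex n → SinkAlgorithm n) : SinkAlgorithm n

/-- The vertex that the algorithm outputs when the oracle is `o`. -/
def SinkAlgorithm.result {n : ℕ} (o : Outmap n) : SinkAlgorithm n → Vertex n
  | .output v => v
  | .query v next => (next (o v)).result o

/-- The number of vertex evaluations that the algorithm performs when the oracle is `o`. -/
def SinkAlgorithm.numQueries {n : ℕ} (o : Outmap n) : SinkAlgorithm n → ℕ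
  | .output _ => 0
  | .query v next => (next (o v)).numQueries o + 1

end MatousekUSO

/-!
A Matoušek-type orientation is an affine map `o v = N (v + s)` over `GF(2)`, where `N` has ones on
the diagonal and is otherwise the adjacency matrix of an acyclic influence graph on the dimensions.

*Realizability makes the influence graph a forest order.* The four basic solutions at the vertices
of a two-dimensional face depend only on the two nonbasic variables, so they lie in a plane and
satisfy an affine dependence (`IsNondegenerate.exists_affine_dependence`; non-degeneracy makes all
basis matrices invertible). The signs of its coefficients can be read off from the orientation of
the face, and the sign of any third coordinate at the fourth vertex is then restricted by those at
the other three (`no_bad_triple`). Taking `s`, the sink, as the base vertex, this forbids exactly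
the influence patterns `i → j → k` without `i → k`, and `i → k ← j` with `i` and `j` unrelated.
Hence influence is transitive and the influencers of a dimension form a chain
(`isForestType_of_isRealizable`).

*A forest can be learned with `O(log² n)` queries.* A query at `v` returns, together with `o 0`, the
parity of the number of marked ancestors of each node, where `v` marks nodes. Marking the levels
divisible by `2 ^ k` gives digit `k` of all depths (`learnable_level_mod`). Then the ancestors are
identified on finer and finer grids of levels. Suppose that they are known on the levels divisible
by `2 * h`. Marking, on the odd multiples of `h`, the nodes whose index has digit `t` equal to `1`
reveals that digit for all ancestors on these levels: exactly one odd multiple lies between two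
neighbouring levels of the known grid, so the difference of two answers isolates it
(`IsForestOrder.rel_of_same_answers`, `learnable_grid`). There are `O(log n)` grids, each with
`O(log n)` digits. At the end `o` is determined, and thereby its sink.

The adaptive strategy is not written down as a program: `Learnable k 𝒞 E` says that some decision
tree of depth `k` separates outmaps up to `E`, and what is learned is expressed by the relation `E`
between two outmaps that gave the same answers.
-/

namespace MatousekUSO

/-! ### Forest orders -/

/-- The ancestor relation of a rooted forest: `r j i` says that `j` is an ancestor of `i` or `i`
itself. It is a partial order in which the elements below a given one form a chain. -/
structure IsForestOrder {ι : Type*} (r : ι → ι → Prop) : Prop where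
  refl : ∀ i, r i i
  trans : ∀ {i j k}, r i j → r j k → r i k
  antisymm : ∀ {i j}, r i j → r j i → i = j
  chain : ∀ {i j k}, r i k → r j k → r i j ∨ r j i

section Forest

variable {ι : Type*} [Fintype ι] {r : ι → ι → Prop}

open Classical in
/-- The ancestors of `i`, including `i` itself. -/
noncomputable def ancestors (r : ι → ι → Prop) (i : ι) : Finset ι :=
  Finset.univ.filter fun j => r j i

/-- The depth of `i` in the forest; roots have depth `1`. -/
noncomputable def depth (r : ι → ι → Prop) (i : ι) : ℕ :=
  (ancestors r i).card

lemma mem_ancestors {i j : ι} : j ∈ ancestors r i ↔ r j i := by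
  simp [ancestors]

lemma depth_le_card (i : ι) : depth r i ≤ Fintype.card ι :=
  Finset.card_le_univ _

namespace IsForestOrder

lemma ancestors_subset (hr : IsForestOrder r) {i j : ι} (h : r j i) :
    ancestors r j ⊆ ancestors r i := fun _ hk =>
  mem_ancestors.2 (hr.trans (mem_ancestors.1 hk) h)

lemma depth_le (hr : IsForestOrder r) {i j : ι} (h : r j i) : depth r j ≤ depth r i :=
  Finset.card_le_card (hr.ancestors_subset h)

lemma one_le_depth (hr : IsForestOrder r) (i : ι) : 1 ≤ depth r i :=
  Finset.card_pos.2 ⟨i, mem_ancestors.2 (hr.refl i)⟩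

lemma eq_of_depth_le (hr : IsForestOrder r) {i j : ι} (h : r j i) (hd : depth r i ≤ depth r j) :
    j = i := by
  have := Finset.eq_of_subset_of_card_le (hr.ancestors_subset h) hd
  have hi : i ∈ ancestors r j := this ▸ mem_ancestors.2 (hr.refl i)
  exact hr.antisymm h (mem_ancestors.1 hi)

lemma rel_of_depth_le (hr : IsForestOrder r) {i j k : ι} (hj : r j i) (hk : r k i)
    (hd : depth r j ≤ depth r k) : r j k := by
  rcases hr.chain hj hk with h | h
  · exact h
  · exact hr.eq_of_depth_le h hd ▸ hr.refl k

lemma eq_of_depth_eq (hr : IsForestOrder r) {i j k : ι} (hj : r j i) (hk : r k i)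
    (hd : depth r j = depth r k) : j = k :=
  hr.eq_of_depth_le (hr.rel_of_depth_le hj hk hd.le) hd.ge

/-- The ancestors of `i` lie on the levels `1, …, depth r i`, one on each. -/
lemma image_depth_ancestors (hr : IsForestOrder r) (i : ι) :
    (ancestors r i).image (depth r) = Finset.Ioc 0 (depth r i) := by
  apply Finset.eq_of_subset_of_card_le
  · intro ℓ hℓ
    obtain ⟨j, hj, rfl⟩ := Finset.mem_image.1 hℓ
    exact Finset.mem_Ioc.2 ⟨hr.one_le_depth j, hr.depth_le (mem_ancestors.1 hj)⟩
  · rw [Finset.card_image_of_injOn, Nat.card_Ioc]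
    · exact le_rfl
    · intro j hj k hk h
      exact hr.eq_of_depth_eq (mem_ancestors.1 hj) (mem_ancestors.1 hk) h

lemma exists_ancestor (hr : IsForestOrder r) (i : ι) {ℓ : ℕ} (h0 : 0 < ℓ) (h : ℓ ≤ depth r i) :
    ∃ j, r j i ∧ depth r j = ℓ := by
  have : ℓ ∈ (ancestors r i).image (depth r) := by
    rw [hr.image_depth_ancestors]
    exact Finset.mem_Ioc.2 ⟨h0, h⟩
  obtain ⟨j, hj, rfl⟩ := Finset.mem_image.1 this
  exact ⟨j, mem_ancestors.1 hj, rfl⟩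

/-- Counting the ancestors on every `m`-th level divides the depth by `m`. -/
lemma card_ancestors_dvd_depth (hr : IsForestOrder r) (i : ι) (m : ℕ) :
    ((ancestors r i).filter fun j => m ∣ depth r j).card = depth r i / m := by
  rw [← Nat.Ioc_filter_dvd_card_eq_div, ← hr.image_depth_ancestors, Finset.filter_image,
    Finset.card_image_of_injOn]
  intro j hj k hk h
  have hj := (Finset.mem_filter.1 hj).1
  have hk := (Finset.mem_filter.1 hk).1
  exact hr.eq_of_depth_eq (mem_ancestors.1 hj) (mem_ancestors.1 hk) h

/-- A function supported on the levels that are odd multiples of `h`, summed over the ancestors of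
a node `x` between the levels `ℓ` and `ℓ + h`, where `ℓ` is an odd multiple of `h`: the ancestor
`j` on level `ℓ` contributes the last term. -/
lemma sum_ancestors_eq {R : Type*} [AddCommMonoid R] (hr : IsForestOrder r) {T : ι → R} {h m : ℕ}
    (hh : 0 < h) (hT : ∀ z, depth r z % (2 * h) ≠ h → T z = 0) {x j : ι} (hj : r j x)
    (hdj : depth r j = h * (2 * m + 1)) (hx : depth r x ≤ h * (2 * m + 2)) :
    ∑ z ∈ ancestors r x, T z = ∑ z ∈ ancestors r x with depth r z ≤ h * (2 * m), T z + T j := by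
  classical
  have hnot : j ∉ (ancestors r x).filter fun z => depth r z ≤ h * (2 * m) := by
    simp only [Finset.mem_filter, hdj, not_and, not_le]
    intro _
    nlinarith
  rw [add_comm, ← Finset.sum_insert hnot]
  symm
  apply Finset.sum_subset
  · intro z hz
    rcases Finset.mem_insert.1 hz with rfl | hz
    · exact mem_ancestors.2 hj
    · exact (Finset.mem_filter.1 hz).1
  · intro z hz hz'
    apply hT
    intro hmod
    apply hz'
    have hzx := mem_ancestors.1 hz
    have hle := (hr.depth_le hzx).trans hx
    have hdz : depth r z = h * (2 * (depth r z / (2 * h)) + 1) := by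
      conv_lhs => rw [← Nat.div_add_mod (depth r z) (2 * h), hmod]
      ring
    set a := depth r z / (2 * h)
    rcases lt_or_ge a m with ham | ham
    · refine Finset.mem_insert_of_mem (Finset.mem_filter.2 ⟨hz, ?_⟩)
      rw [hdz]
      exact Nat.mul_le_mul_left _ (by omega)
    · have : 2 * a + 1 ≤ 2 * m + 2 := Nat.le_of_mul_le_mul_left (hdz ▸ hle) hh
      have ham' : a = m := by omega
      rw [hr.eq_of_depth_eq hzx hj (by rw [hdz, hdj, ham'])]
      exact Finset.mem_insert_self _ _

/-- If `y` is the ancestor of `x` on level `ℓ`, then the ancestors of `x` up to level `ℓ` are those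
of `y`. -/
lemma filter_ancestors_depth_le (hr : IsForestOrder r) {x y : ι} (hy : r y x) :
    ((ancestors r x).filter fun z => depth r z ≤ depth r y) = ancestors r y := by
  ext z
  simp only [Finset.mem_filter, mem_ancestors]
  exact ⟨fun hz => hr.rel_of_depth_le hz.1 hy hz.2, fun hz => ⟨hr.trans hz hy, hr.depth_le hz⟩⟩

/-- The reconstruction of one level of the forest from the next coarser grid of levels. Two forests
have the same depths, the same ancestors on the levels divisible by `2 * h`, and the same answers to
the queries `T t`, which read the labels `f t` on the levels that are odd multiples of `h`. If the
labels separate nodes, then the forests have the same ancestors on the levels divisible by `h`. -/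
lemma rel_of_same_answers {r' : ι → ι → Prop} {R τ : Type*} [AddCommGroup R]
    (hr : IsForestOrder r) (hr' : IsForestOrder r') (hd : ∀ i, depth r i = depth r' i) {h : ℕ}
    (hh : 0 < h) (hgrid : ∀ i j, 2 * h ∣ depth r j → (r j i ↔ r' j i)) {f T : τ → ι → R}
    (hf : ∀ i j, (∀ t, f t i = f t j) → i = j)
    (hT : ∀ t z, T t z = if depth r z % (2 * h) = h then f t z else 0)
    (hQ : ∀ t i, ∑ z ∈ ancestors r i, T t z = ∑ z ∈ ancestors r' i, T t z) {i j : ι}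
    (hdvd : h ∣ depth r j) (hji : r j i) : r' j i := by
  by_cases h2 : 2 * h ∣ depth r j
  · exact (hgrid i j h2).1 hji
  obtain ⟨c, hc⟩ := hdvd
  obtain ⟨m, rfl⟩ : Odd c := by
    rw [← Nat.not_even_iff_odd]
    rintro ⟨b, rfl⟩
    exact h2 ⟨b, by rw [hc]; ring⟩
  have hmod : ∀ z, depth r z = h * (2 * m + 1) → depth r z % (2 * h) = h := by
    intro z hz
    rw [hz, show h * (2 * m + 1) = h + 2 * h * m by ring, Nat.add_mul_mod_self_left,
      Nat.mod_eq_of_lt (by omega)]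
  have hle := hr.depth_le hji
  obtain ⟨j', hj'i, hdj'⟩ := hr'.exists_ancestor i (hc ▸ hr.one_le_depth j) (hd i ▸ hc ▸ hle)
  suffices j = j' from this ▸ hj'i
  -- a node `x` above or equal to `i` in both forests, between the levels `ℓ` and `ℓ + h`, where
  -- `ℓ = h * (2 * m + 1)` is the level of `j`: either `i` or an ancestor on the coarser grid
  obtain ⟨x, hxi, hxi', hx1, hx2⟩ : ∃ x, r x i ∧ r' x i ∧ h * (2 * m + 1) ≤ depth r x ∧
      depth r x ≤ h * (2 * m + 2) := by
    rcases le_total (depth r i) (h * (2 * m + 2)) with h1 | h1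
    · exact ⟨i, hr.refl i, hr'.refl i, hc ▸ hle, h1⟩
    · obtain ⟨x, hx, hdx⟩ := hr.exists_ancestor i (by positivity) h1
      refine ⟨x, hx, (hgrid i x ⟨m + 1, by rw [hdx]; ring⟩).1 hx, ?_, hdx.le⟩
      rw [hdx]
      exact Nat.mul_le_mul_left _ (by omega)
  have hjx := hr.rel_of_depth_le hji hxi (hc ▸ hx1)
  have hj'x := hr'.rel_of_depth_le hj'i hxi' (by rw [hdj', ← hd]; exact hx1)
  have hT0 : ∀ t z, depth r z % (2 * h) ≠ h → T t z = 0 := fun t z hz => by rw [hT, if_neg hz]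
  -- up to level `ℓ - h`, which is on the coarser grid or `0`, the two forests have equal sums
  have hlow : ∀ t, ∑ z ∈ ancestors r x with depth r z ≤ h * (2 * m), T t z =
      ∑ z ∈ ancestors r' x with depth r' z ≤ h * (2 * m), T t z := by
    intro t
    rcases Nat.eq_zero_or_pos m with rfl | hm
    · rw [Finset.sum_eq_zero, Finset.sum_eq_zero]
      · intro z hz
        have := hr'.one_le_depth z
        have := (Finset.mem_filter.1 hz).2
        omega
      · intro z hz
        have := hr.one_le_depth z
        have := (Finset.mem_filter.1 hz).2
        omega
    · obtain ⟨y, hyx, hdy⟩ := hr.exists_ancestor x (ℓ := h * (2 * m)) (by positivity)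
        ((Nat.mul_le_mul_left _ (by omega)).trans hx1)
      have hyi' := (hgrid x y ⟨m, by rw [hdy]; ring⟩).1 hyx
      have h1 := hr.filter_ancestors_depth_le hyx
      have h2 := hr'.filter_ancestors_depth_le hyi'
      rw [← hd, hdy] at h2
      rw [hdy] at h1
      rw [h1, h2, hQ]
  apply hf
  intro t
  have h1 := hr.sum_ancestors_eq hh (hT0 t) hjx hc hx2
  have h2 := hr'.sum_ancestors_eq hh (T := T t) (fun z hz => hT0 t z (by rwa [hd])) hj'x hdj'
    (by rwa [← hd])
  have h3 : T t j = T t j' := by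
    have h4 := hQ t x
    rw [h1, h2, hlow] at h4
    exact add_left_cancel h4
  rwa [hT, hT, if_pos (hmod j hc), if_pos (hmod j' (by rw [hd, hdj']))] at h3

end IsForestOrder

end Forest

/-! ### The influence relation of a realizable Matoušek-type orientation -/

/-- Dimension `j` influences dimension `i` if moving along `j` from the vertex `0` changes the
direction of the edge in dimension `i`. -/
def influences {n : ℕ} (o : Outmap n) (j i : Fin n) : Prop :=
  o (Pi.single j 1) i ≠ o 0 i

/-- The orientations whose outmap is affine, with the ancestor matrix of a forest as linear
part. -/
structure IsForestType {n : ℕ} (o : Outmap n) : Prop where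
  forest : IsForestOrder (influences o)
  affine : ∀ v i, o v i = o 0 i + ∑ j ∈ ancestors (influences o) i, v j

section Realizable

variable {n : ℕ} {M : Matrix (Fin n) (Fin n) ℝ} {q : Fin n → ℝ}

lemma IsNondegenerate.isUnit_det (hq : IsNondegenerate M q) (v : Vertex n) (i : Fin n) :
    IsUnit (basisMatrix M v).det := by
  by_contra h
  exact hq v i (by simp [basicValue, Matrix.nonsing_inv_apply_not_isUnit _ h])

lemma basisMatrix_congr {v w : Vertex n} {l : Fin n} (h : v l = w l) (k : Fin n) :
    basisMatrix M v k l = basisMatrix M w k l := by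
  simp [basisMatrix, h]

/-- The basic solutions at the four vertices of a two-dimensional face lie in a plane, so they are
affinely dependent: the one at the vertex opposite to `s` is the combination of the others with
coefficients `α`, `β`, `γ`. Only the coordinates that matter for signs are recorded. -/
lemma IsNondegenerate.exists_affine_dependence (hq : IsNondegenerate M q) (s : Vertex n)
    {i j : Fin n} (hij : i ≠ j) :
    ∃ α β γ : ℝ,
      basicValue M q (s + Pi.single i 1 + Pi.single j 1) i
        = β * basicValue M q (s + Pi.single i 1) i ∧
      basicValue M q (s + Pi.single i 1 + Pi.single j 1) j
        = γ * basicValue M q (s + Pi.single j 1) j ∧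
      α * basicValue M q s i + γ * basicValue M q (s + Pi.single j 1) i = 0 ∧
      ∀ k, k ≠ i → k ≠ j →
        basicValue M q (s + Pi.single i 1 + Pi.single j 1) k
          = α * basicValue M q s k + β * basicValue M q (s + Pi.single i 1) k
            + γ * basicValue M q (s + Pi.single j 1) k := by
  have hB : ∀ v k, ∑ l, basisMatrix M v k l * basicValue M q v l = q k := by
    intro v k
    have : (basisMatrix M v).mulVec (basicValue M q v) = q := by
      rw [basicValue, Matrix.mulVec_mulVec, Matrix.mul_nonsing_inv _ (hq.isUnit_det v i),
        Matrix.one_mulVec]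
    exact congrFun this k
  have c1 : ∀ l, l ≠ i → (s + Pi.single i 1 : Vertex n) l = s l := fun l hl => by simp [hl]
  have c2 : ∀ l, l ≠ j → (s + Pi.single j 1 : Vertex n) l = s l := fun l hl => by simp [hl]
  have c3 : ∀ l, l ≠ j → (s + Pi.single i 1 + Pi.single j 1 : Vertex n) l
      = (s + Pi.single i 1 : Vertex n) l := fun l hl => by simp [hl]
  have c4 : ∀ l, l ≠ i → (s + Pi.single i 1 + Pi.single j 1 : Vertex n) l
      = (s + Pi.single j 1 : Vertex n) l := fun l hl => by simp [hl]
  generalize (s + Pi.single i 1 + Pi.single j 1 : Vertex n) = v₃ at *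
  generalize (s + Pi.single i 1 : Vertex n) = v₁ at *
  generalize (s + Pi.single j 1 : Vertex n) = v₂ at *
  set x := basicValue M q
  set β := x v₃ i / x v₁ i
  set γ := x v₃ j / x v₂ j
  have hβ : x v₃ i = β * x v₁ i := (div_mul_cancel₀ _ (hq v₁ i)).symm
  have hγ : x v₃ j = γ * x v₂ j := (div_mul_cancel₀ _ (hq v₂ j)).symm
  -- the dependence, in terms of the columns of the basis at `s`
  set y : Fin n → ℝ := fun l =>
    if l = i then -((1 - β - γ) * x s i + γ * x v₂ i)
    else if l = j then -((1 - β - γ) * x s j + β * x v₁ j)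
    else x v₃ l - ((1 - β - γ) * x s l + β * x v₁ l + γ * x v₂ l) with hy
  have hBy : (basisMatrix M s).mulVec y = 0 := by
    ext k
    have hterm : ∀ l, basisMatrix M s k l * y l = basisMatrix M v₃ k l * x v₃ l
        - ((1 - β - γ) * (basisMatrix M s k l * x s l) + β * (basisMatrix M v₁ k l * x v₁ l)
          + γ * (basisMatrix M v₂ k l * x v₂ l)) := by
      intro l
      by_cases hi : l = i
      · subst hi
        rw [basisMatrix_congr (c3 l hij), basisMatrix_congr (c2 l hij), hβ]
        simp only [hy, if_true]
        ring
      · by_cases hj : l = j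
        · subst hj
          rw [basisMatrix_congr (c4 l hi), basisMatrix_congr (c1 l hi), hγ]
          simp only [hy, if_neg hi, if_true]
          ring
        · rw [basisMatrix_congr (c3 l hj), basisMatrix_congr (c2 l hj), basisMatrix_congr (c1 l hi)]
          simp only [hy, if_neg hi, if_neg hj]
          ring
    simp only [Matrix.mulVec, dotProduct, Pi.zero_apply]
    rw [Finset.sum_congr rfl fun l _ => hterm l, Finset.sum_sub_distrib, Finset.sum_add_distrib,
      Finset.sum_add_distrib, ← Finset.mul_sum, ← Finset.mul_sum, ← Finset.mul_sum, hB, hB, hB, hB]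
    ring
  have hy0 : y = 0 := by
    have := congrArg (Matrix.mulVec (basisMatrix M s)⁻¹) hBy
    rwa [Matrix.mulVec_mulVec, Matrix.nonsing_inv_mul _ (hq.isUnit_det s i), Matrix.one_mulVec,
      Matrix.mulVec_zero] at this
  refine ⟨1 - β - γ, β, γ, hβ, hγ, ?_, ?_⟩
  · have := congrFun hy0 i
    simp only [hy, if_true, Pi.zero_apply] at this
    linarith
  · intro k hki hkj
    have := congrFun hy0 k
    simp only [hy, if_neg hki, if_neg hkj, Pi.zero_apply] at this
    linarith

/-- For a realizable orientation with linear part `N`, the influences of two dimensions `i` and `j`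
on a third one are restricted as soon as `j` does not influence `i`: the pair `(N k i, N k j)`
cannot be `(0, 1)` if `i` influences `j`, nor `(1, 1)` if it does not. -/
lemma no_bad_triple {o : Outmap n} {N : Matrix (Fin n) (Fin n) (ZMod 2)} {s : Vertex n}
    (hN : ∀ v, o v = N.mulVec (v + s)) (hdiag : ∀ i, N i i = 1) (hq : IsNondegenerate M q)
    (ho : ∀ v i, o v i = 1 ↔ basicValue M q v i < 0) {i j k : Fin n} (hij : i ≠ j) (hik : i ≠ k)
    (hjk : j ≠ k) (h : N i j = 0) (hkj : N k j = 1) : N k i ≠ 1 - N j i := by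
  intro hki
  obtain ⟨α, β, γ, hβ, hγ, hα, hk⟩ := hq.exists_affine_dependence s hij
  have hk := hk k hik.symm hjk.symm
  have hpos : ∀ v l, o v l = 0 → 0 < basicValue M q v l := by
    intro v l hl
    refine lt_of_le_of_ne (not_lt.1 fun hlt => ?_) (hq v l).symm
    rw [(ho v l).2 hlt] at hl
    exact one_ne_zero hl
  have hneg : ∀ v l, o v l = 1 → basicValue M q v l < 0 := fun v l => (ho v l).1
  have hss : s + s = 0 := by
    ext l
    exact CharTwo.add_self_eq_zero (s l)
  have o0 : ∀ l, o s l = 0 := fun l => by rw [hN, hss]; simp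
  have o1 : ∀ a l, o (s + Pi.single a 1) l = N l a := fun a l => by
    rw [hN, add_right_comm, hss, zero_add]; simp
  have o3 : ∀ l, o (s + Pi.single i 1 + Pi.single j 1) l = N l i + N l j := fun l => by
    rw [hN, show s + Pi.single i 1 + Pi.single j 1 + s = (s + s) + (Pi.single i 1 + Pi.single j 1)
      by abel, hss, zero_add, Matrix.mulVec_add]
    simp
  have x0i := hpos s i (o0 i)
  have x0k := hpos s k (o0 k)
  have x1i := hneg (s + Pi.single i 1) i (by rw [o1, hdiag])
  have x2i := hpos (s + Pi.single j 1) i (by rw [o1, h])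
  have x2j := hneg (s + Pi.single j 1) j (by rw [o1, hdiag])
  have x2k := hneg (s + Pi.single j 1) k (by rw [o1, hkj])
  have x3i := hneg (s + Pi.single i 1 + Pi.single j 1) i (by rw [o3, hdiag, h, add_zero])
  have βpos : 0 < β := by
    rw [hβ] at x3i
    exact pos_of_mul_neg_left x3i x1i.le
  have h01 : N j i = 0 ∨ N j i = 1 := by
    generalize N j i = a
    revert a
    decide
  rcases h01 with h0 | h1
  · rw [h0, sub_zero] at hki
    have x1k := hneg (s + Pi.single i 1) k (by rw [o1, hki])
    have x3j := hneg (s + Pi.single i 1 + Pi.single j 1) j (by rw [o3, hdiag, h0, zero_add])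
    have x3k := hpos (s + Pi.single i 1 + Pi.single j 1) k (by rw [o3, hki, hkj]; decide)
    rw [hγ] at x3j
    have γpos : 0 < γ := pos_of_mul_neg_left x3j x2j.le
    have αneg : α < 0 := by
      have := mul_pos γpos x2i
      exact neg_of_mul_neg_left (by linarith) x0i.le
    have := mul_neg_of_neg_of_pos αneg x0k
    have := mul_neg_of_pos_of_neg βpos x1k
    have := mul_neg_of_pos_of_neg γpos x2k
    linarith
  · rw [h1, sub_self] at hki
    have x1k := hpos (s + Pi.single i 1) k (by rw [o1, hki])
    have x3j := hpos (s + Pi.single i 1 + Pi.single j 1) j (by rw [o3, hdiag, h1]; decide)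
    have x3k := hneg (s + Pi.single i 1 + Pi.single j 1) k (by rw [o3, hki, hkj, zero_add])
    rw [hγ] at x3j
    have γneg : γ < 0 := neg_of_mul_pos_left x3j x2j.le
    have αpos : 0 < α := by
      have := mul_neg_of_neg_of_pos γneg x2i
      exact pos_of_mul_pos_left (by linarith) x0i.le
    have := mul_pos αpos x0k
    have := mul_pos βpos x1k
    have := mul_pos_of_neg_of_neg γneg x2k
    linarith

end Realizable

/-- The structure theorem: the influence relation of a realizable Matoušek-type orientation is a
forest order. -/
theorem isForestType_of_isRealizable {n : ℕ} {o : Outmap n} (hM : IsMatousekType o)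
    (hR : IsRealizable o) : IsForestType o := by
  classical
  obtain ⟨σ, A, s, -, hA, hoA⟩ := hM
  obtain ⟨⟨hor, -⟩, M, q, -, hq, ho⟩ := hR
  obtain ⟨N, hNdef, hN⟩ : ∃ N : Matrix (Fin n) (Fin n) (ZMod 2),
      (∀ i j, N i j = A (σ i) (σ j)) ∧ ∀ v, o v = N.mulVec (v + s) := by
    refine ⟨_, fun i j => ?_, hoA⟩
    rw [Equiv.Perm.permMatrix, ← PEquiv.toMatrix_symm, ← Equiv.toPEquiv_symm,
      PEquiv.toMatrix_toPEquiv_mul, PEquiv.mul_toMatrix_toPEquiv]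
    simp
  have h01 : ∀ a : ZMod 2, a ≠ 0 → a = 1 := by decide
  have hinf : ∀ {j i}, influences o j i ↔ N i j = 1 := by
    intro j i
    have : o (Pi.single j 1) i = N i j + o 0 i := by
      rw [hN, hN, zero_add, Matrix.mulVec_add]
      simp
    rw [influences, this, Ne, add_eq_right]
    exact ⟨h01 _, fun h => by rw [h]; exact one_ne_zero⟩
  have hdiag : ∀ i, N i i = 1 := by
    intro i
    have h1 := hor 0 i
    rw [zero_add] at h1
    exact hinf.1 h1.symm
  have hanti : ∀ {i j}, N i j = 1 → N j i = 1 → i = j := by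
    intro i j h1 h2
    rw [hNdef] at h1 h2
    apply σ.injective
    apply le_antisymm
    · by_contra hlt
      rw [hA (not_le.1 hlt)] at h1
      exact zero_ne_one h1
    · by_contra hlt
      rw [hA (not_le.1 hlt)] at h2
      exact zero_ne_one h2
  have h0 : ∀ {i j}, N i j ≠ 1 → N i j = 0 := fun h => by_contra fun h' => h (h01 _ h')
  refine ⟨⟨fun i => hinf.2 (hdiag i), ?_, ?_, ?_⟩, ?_⟩
  · intro i j k hij hjk
    by_cases eij : i = j
    · exact eij ▸ hjk
    by_cases ejk : j = k
    · exact ejk ▸ hij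
    rw [hinf] at *
    by_cases eik : i = k
    · subst eik
      exact hdiag i
    by_contra hik
    refine no_bad_triple hN hdiag hq ho eij eik ejk (h0 fun h => eij (hanti h hij)) hjk ?_
    rw [h0 hik, hij, sub_self]
  · intro i j hij hji
    rw [hinf] at *
    exact hanti hji hij
  · intro i j k hik hjk
    by_cases eij : i = j
    · exact Or.inl (eij ▸ hinf.2 (hdiag i))
    by_cases eik : i = k
    · exact Or.inr (eik ▸ hjk)
    by_cases ejk : j = k
    · exact Or.inl (ejk ▸ hik)
    rw [hinf] at *
    by_contra! hcon
    refine no_bad_triple hN hdiag hq ho eij eik ejk (h0 (hinf.not.1 hcon.2)) hjk ?_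
    rw [h0 hcon.1, hik, sub_zero]
  · intro v i
    rw [hN, hN, zero_add, Matrix.mulVec_add, Pi.add_apply, add_comm]
    congr 1
    simp only [Matrix.mulVec, dotProduct, ancestors, Finset.sum_filter]
    refine Finset.sum_congr rfl fun j _ => ?_
    split_ifs with h
    · rw [hinf.1 h, one_mul]
    · rw [h0 (hinf.not.1 h), zero_mul]

/-! ### Adaptive queries -/

/-- Some decision tree with `k` vertex evaluations on each branch separates the outmaps in `𝒞` well
enough that any two of them that give the same answers, and so end in the same leaf, are related by
`E`. -/
def Learnable {n : ℕ} : ℕ → Set (Outmap n) → (Outmap n → Outmap n → Prop) → Prop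
  | 0, 𝒞, E => ∀ o ∈ 𝒞, ∀ o' ∈ 𝒞, E o o'
  | k + 1, 𝒞, E => ∃ v, ∀ y, Learnable k {o ∈ 𝒞 | o v = y} E

section Learnable

variable {n : ℕ} {𝒞 : Set (Outmap n)} {E E' : Outmap n → Outmap n → Prop}

lemma Learnable.weaken {k : ℕ} (h : Learnable k 𝒞 E)
    (hE : ∀ o ∈ 𝒞, ∀ o' ∈ 𝒞, E o o' → E' o o') : Learnable k 𝒞 E' := by
  induction k generalizing 𝒞 with
  | zero => exact fun o ho o' ho' => hE o ho o' ho' (h o ho o' ho')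
  | succ k ih =>
    obtain ⟨v, hv⟩ := h
    exact ⟨v, fun y => ih (hv y) fun o ho o' ho' => hE o ho.1 o' ho'.1⟩

/-- A further query, at a vertex that is determined by what has been learned so far. -/
lemma Learnable.query {k : ℕ} (h : Learnable k 𝒞 E) (V : Outmap n → Vertex n)
    (hV : ∀ o ∈ 𝒞, ∀ o' ∈ 𝒞, E o o' → V o = V o') :
    Learnable (k + 1) 𝒞 fun o o' => E o o' ∧ o (V o) = o' (V o') := by
  induction k generalizing 𝒞 with
  | zero =>
    rcases 𝒞.eq_empty_or_nonempty with rfl | ⟨o₀, ho₀⟩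
    · exact ⟨0, fun y o ho => ho.1.elim⟩
    · refine ⟨V o₀, fun y o ho o' ho' => ⟨h o ho.1 o' ho'.1, ?_⟩⟩
      rw [← hV o₀ ho₀ o ho.1 (h _ ho₀ _ ho.1), ← hV o₀ ho₀ o' ho'.1 (h _ ho₀ _ ho'.1), ho.2, ho'.2]
  | succ k ih =>
    obtain ⟨v, hv⟩ := h
    exact ⟨v, fun y => ih (hv y) fun o ho o' ho' => hV o ho.1 o' ho'.1⟩

lemma Learnable.queries {k : ℕ} (h : Learnable k 𝒞 E) (V : ℕ → Outmap n → Vertex n)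
    (hV : ∀ t, ∀ o ∈ 𝒞, ∀ o' ∈ 𝒞, E o o' → V t o = V t o') (L : ℕ) :
    Learnable (k + L) 𝒞 fun o o' => E o o' ∧ ∀ t < L, o (V t o) = o' (V t o') := by
  induction L with
  | zero => exact h.weaken fun o _ o' _ hE => ⟨hE, by simp⟩
  | succ L ih =>
    refine (ih.query (V L) fun o ho o' ho' hE => hV L o ho o' ho' hE.1).weaken ?_
    rintro o - o' - ⟨⟨hE, hlt⟩, hL⟩
    exact ⟨hE, fun t ht => (Nat.lt_succ_iff_lt_or_eq.1 ht).elim (hlt t) fun e => e ▸ hL⟩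

/-- If the outmap can be identified with `k` queries, then its sink, if there is one, can be found
with `k` queries. -/
lemma Learnable.exists_algorithm {k : ℕ} (h : Learnable k 𝒞 Eq) :
    ∃ a : SinkAlgorithm n, ∀ o ∈ 𝒞,
      ((∃ v, IsSink o v) → IsSink o (a.result o)) ∧ a.numQueries o = k := by
  induction k generalizing 𝒞 with
  | zero =>
    by_cases hs : ∃ o ∈ 𝒞, ∃ v, IsSink o v
    · obtain ⟨o₀, ho₀, v, hv⟩ := hs
      exact ⟨.output v, fun o ho => ⟨fun _ => h o₀ ho₀ o ho ▸ hv, rfl⟩⟩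
    · exact ⟨.output 0, fun o ho => ⟨fun hv => (hs ⟨o, ho, hv⟩).elim, rfl⟩⟩
  | succ k ih =>
    obtain ⟨v, hv⟩ := h
    choose a ha using fun y => ih (hv y)
    refine ⟨.query v a, fun o ho => ?_⟩
    obtain ⟨h1, h2⟩ := ha (o v) o ⟨ho, rfl⟩
    exact ⟨h1, congrArg (· + 1) h2⟩

end Learnable

/-! ### Learning the forest -/

/-- The depth of a dimension in the influence forest. -/
noncomputable abbrev level {n : ℕ} (o : Outmap n) : Fin n → ℕ :=
  depth (influences o)

/-- One query for the value at `0`, and one for each binary digit of the depths: the number of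
ancestors on levels divisible by `2 ^ k` is the depth divided by `2 ^ k`, and its parity is the next
digit. -/
lemma learnable_level_mod (n k : ℕ) :
    Learnable (1 + k) {o : Outmap n | IsForestType o} fun o o' =>
      o 0 = o' 0 ∧ ∀ i, level o i % 2 ^ k = level o' i % 2 ^ k := by
  induction k with
  | zero =>
    have h : Learnable 0 {o : Outmap n | IsForestType o} fun _ _ => True := fun _ _ _ _ => trivial
    refine (h.query (fun _ => 0) fun _ _ _ _ _ => rfl).weaken ?_
    rintro o - o' - ⟨-, h⟩
    exact ⟨h, by simp [Nat.mod_one]⟩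
  | succ k ih =>
    refine (ih.query (fun o i => if 2 ^ k ∣ level o i then 1 else 0) ?_).weaken ?_
    · rintro o - o' - ⟨-, h⟩
      ext i
      simp only [Nat.dvd_iff_mod_eq_zero, h i]
    · rintro o ho o' ho' ⟨⟨h0, hmod⟩, hQ⟩
      refine ⟨h0, fun i => ?_⟩
      have hcount : ∀ o : Outmap n, IsForestType o →
          o (fun i => if 2 ^ k ∣ level o i then 1 else 0) i
            = o 0 i + ((level o i / 2 ^ k : ℕ) : ZMod 2) := by
        intro o ho
        rw [ho.affine, Finset.sum_boole, ho.forest.card_ancestors_dvd_depth]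
      have h1 := congrFun hQ i
      rw [hcount o ho, hcount o' ho', h0, add_right_inj, ZMod.natCast_eq_natCast_iff'] at h1
      rw [pow_succ, Nat.mod_mul, Nat.mod_mul, hmod, h1]

/-- The vertex that reads digit `t` of the index of the ancestor on the levels that are odd
multiples of `h`. -/
noncomputable def digitVertex {n : ℕ} (h t : ℕ) (o : Outmap n) : Vertex n := fun z =>
  if level o z % (2 * h) = h then (if (z : ℕ).testBit t then 1 else 0) else 0

/-- With `L` queries, the grid of levels on which all ancestors are known is refined by a factor of
two. -/
lemma learnable_grid {n L : ℕ} (hL : n < 2 ^ L) {m : ℕ} (hm : m ≤ L) :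
    Learnable (1 + L + m * L) {o : Outmap n | IsForestType o} fun o o' =>
      (o 0 = o' 0 ∧ ∀ i, level o i = level o' i) ∧
        ∀ i j, 2 ^ (L - m) ∣ level o j → (influences o j i ↔ influences o' j i) := by
  induction m with
  | zero =>
    have hlt : ∀ (o : Outmap n) i, level o i < 2 ^ L := fun o i =>
      (depth_le_card i).trans_lt (by rwa [Fintype.card_fin])
    rw [zero_mul]
    refine (learnable_level_mod n L).weaken ?_
    rintro o ho o' - ⟨h0, h⟩
    refine ⟨⟨h0, fun i => ?_⟩, fun i j hdvd => ?_⟩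
    · have := h i
      rwa [Nat.mod_eq_of_lt (hlt _ _), Nat.mod_eq_of_lt (hlt _ _)] at this
    · exact absurd (Nat.le_of_dvd (ho.forest.one_le_depth j) hdvd) (not_le.2 (hlt o j))
  | succ m ih =>
    set h := 2 ^ (L - (m + 1)) with hh
    have hpos : 0 < h := by positivity
    have h2 : 2 ^ (L - m) = 2 * h := by
      rw [hh, ← pow_succ', show L - m = L - (m + 1) + 1 by omega]
    rw [h2] at ih
    have key := (ih (by omega)).queries (fun t o => digitVertex h t o) (by
      rintro t o - o' - ⟨⟨-, hd⟩, -⟩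
      ext z
      simp only [digitVertex, hd z]) L
    rw [show 1 + L + (m + 1) * L = 1 + L + m * L + L by ring]
    refine key.weaken ?_
    rintro o ho o' ho' ⟨⟨⟨h0, hd⟩, hgrid⟩, hQ⟩
    refine ⟨⟨h0, hd⟩, fun i j hdvd => ?_⟩
    have hdig : ∀ t : ℕ, digitVertex h t o' = digitVertex h t o := by
      intro t
      ext z
      simp only [digitVertex, hd z]
    have hf : ∀ a b : Fin n, (∀ t : Fin L, (if (a : ℕ).testBit t then 1 else 0 : ZMod 2)
        = if (b : ℕ).testBit t then 1 else 0) → a = b := by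
      intro a b hab
      apply Fin.ext
      apply Nat.eq_of_testBit_eq
      intro t
      rcases lt_or_ge t L with ht | ht
      · have := hab ⟨t, ht⟩
        by_cases ha : (a : ℕ).testBit t <;> by_cases hb : (b : ℕ).testBit t <;> simp_all
      · have hbig : ∀ c : Fin n, (c : ℕ).testBit t = false := fun c =>
          Nat.testBit_lt_two_pow ((c.2.trans hL).trans_le (Nat.pow_le_pow_right (by norm_num) ht))
        rw [hbig, hbig]
    have hQ' : ∀ (t : Fin L) i, ∑ z ∈ ancestors (influences o) i, digitVertex h t o z
        = ∑ z ∈ ancestors (influences o') i, digitVertex h t o z := by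
      intro t i
      have := congrFun (hQ t t.2) i
      rw [ho.affine, ho'.affine, h0, add_right_inj, hdig] at this
      exact this
    constructor
    · exact ho.forest.rel_of_same_answers ho'.forest hd hpos hgrid hf (fun t z => rfl) hQ' hdvd
    · exact ho'.forest.rel_of_same_answers ho.forest (fun i => (hd i).symm) hpos
        (fun i j hij => (hgrid i j ((hd j).symm ▸ hij)).symm) hf
        (fun t z => by rw [← hdig]; rfl) (fun t i => (hQ' t i).symm)
        (hd j ▸ hdvd : h ∣ level o' j)

lemma learnable_eq {n L : ℕ} (hL : n < 2 ^ L) :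
    Learnable (1 + L + L * L) {o : Outmap n | IsForestType o} Eq := by
  refine (learnable_grid hL le_rfl).weaken ?_
  rintro o ho o' ho' ⟨⟨h0, -⟩, hinf⟩
  have hrel : influences o = influences o' := by
    ext j i
    exact hinf i j (by simp)
  ext v i
  rw [ho.affine, ho'.affine, h0, hrel]

end MatousekUSO

theorem theorem2 :
    ∃ (𝒜 : ∀ n : ℕ, MatousekUSO.SinkAlgorithm n) (C : ℝ),
      ∀ (n : ℕ) (o : MatousekUSO.Outmap n),
        MatousekUSO.IsMatousekType o → MatousekUSO.IsRealizable o →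
          MatousekUSO.IsSink o ((𝒜 n).result o) ∧
            (2 ≤ n → ((𝒜 n).numQueries o : ℝ) ≤ C * (Real.log n) ^ 2) := by
  have hlearn : ∀ n : ℕ, MatousekUSO.Learnable
      (1 + (Nat.log 2 n + 1) + (Nat.log 2 n + 1) * (Nat.log 2 n + 1))
      {o : MatousekUSO.Outmap n | MatousekUSO.IsForestType o} Eq := fun n =>
    MatousekUSO.learnable_eq (Nat.lt_pow_succ_log_self one_lt_two n)
  choose 𝒜 h𝒜 using fun n => (hlearn n).exists_algorithm
  refine ⟨𝒜, 12 / Real.log 2 ^ 2, fun n o hM hR => ?_⟩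
  obtain ⟨hsink, hnum⟩ := h𝒜 n o (MatousekUSO.isForestType_of_isRealizable hM hR)
  constructor
  · obtain ⟨v, ⟨-, hv⟩, -⟩ := hR.1.2 0 Set.univ
    exact hsink ⟨v, funext fun i => hv i trivial⟩
  · intro hn
    rw [hnum]
    have hlog2 : 0 < Real.log 2 := Real.log_pos one_lt_two
    set x : ℝ := Real.log n / Real.log 2 with hx
    have hle : (Nat.log 2 n : ℝ) ≤ x := by
      have := Real.natLog_le_logb n 2
      rwa [Real.logb, Nat.cast_ofNat] at this
    have h1 : 1 ≤ x := by
      rw [hx, one_le_div hlog2]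
      exact Real.log_le_log two_pos (by exact_mod_cast hn)
    have h0 : (0 : ℝ) ≤ Nat.log 2 n := Nat.cast_nonneg _
    have hC : 12 / Real.log 2 ^ 2 * Real.log n ^ 2 = 12 * x ^ 2 := by
      rw [hx]
      ring
    rw [hC]
    push_cast
    -- with `ℓ = Nat.log 2 n ≤ x`, the number of queries is `3 + 3 * ℓ + ℓ ^ 2`
    nlinarith [mul_le_mul hle hle h0 (h0.trans hle)]
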